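/- Let $\mathcal C$ be a (not necessarily unital) $C^*$-algebra, let $\mathcal A,\mathcal B\subseteq\mathcal C$ be $C^*$-subalgebras (norm-closed $*$-subalgebras), and let $\mathcal D$ be a commutative (not necessarily unital) $C^*$-algebra. For subspaces $S,T$ of a normed space $X$ with closed unit balls $B_1(S)$, $B_1(T)$, the Kadison–Kastler distance is the Hausdorff distance between these balls, $$d_{KK}(S,T)=\max\Big\{\sup_{x\in B_1(S)}\inf_{y\in B_1(T)}\|x-y\|,\ \sup_{y\in B_1(T)}\inf_{x\in B_1(S)}\|x-y\|\Big\}.$$ Let $\mathcal C\otimes^{\min}\mathcal D$ be the minimal (spatial) $C^*$-tensor product, that is, the completion of the algebraic tensor product in the norm $\|x\|_{\min}=\sup_{\pi,\rho}\|(\pi\otimes\rho)(x)\|$, where $\pi$ and $\rho$ run over the representations of $\mathcal C$ and $\mathcal D$ on Hilbert spaces; and let $\mathcal A\otimes^{\min}\mathcal D$ and $\mathcal B\otimes^{\min}\mathcal D$ be regarded as subspaces of $\mathcal C\otimes^{\min}\mathcal D$, namely the closed linear spans of the elementary tensors $a\otimes d$ (with $d\in\mathcal D$ and $a\in\mathcal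 A$, respectively $a\in\mathcal B$). Then $$d_{KK}(\mathcal A\otimes^{\min}\mathcal D,\ \mathcal B\otimes^{\min}\mathcal D)\le d_{KK}(\mathcal A,\mathcal B).$$ Moreover, if $\mathcal D$ is unital and $\mathcal D\neq 0$, then $$d_{KK}(\mathcal A\otimes^{\min}\mathcal D,\ \mathcal B\otimes^{\min}\mathcal D)= d_{KK}(\mathcal A,\mathcal B).$$ -/

import Mathlib

open scoped TensorProduct

universe u v

namespace KadisonKastler

/-- The Kadison-Kastler distance between two subspaces `S`, `T` of a normed space:
the Hausdorff distance between their closed unit balls. (Both balls contain `0` and are bounded,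
so that the real number `Metric.hausdorffDist` is the true Hausdorff distance.) -/
noncomputable def kkDist {X : Type*} [SeminormedAddCommGroup X] [Module ℂ X]
    (S T : Submodule ℂ X) : ℝ :=
  Metric.hausdorffDist {x : X | x ∈ S ∧ ‖x‖ ≤ 1} {x : X | x ∈ T ∧ ‖x‖ ≤ 1}

section Representations

variable {C : Type u} [NonUnitalCStarAlgebra C] {D : Type v} [NonUnitalCStarAlgebra D]
variable {H : Type*} [NormedAddCommGroup H] [InnerProductSpace ℂ H] [CompleteSpace H]
variable {K : Type*} [NormedAddCommGroup K] [InnerProductSpace ℂ K] [CompleteSpace K]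

/-- For representations `π : C → B(H)` and `ρ : D → B(K)`, the representation `π ⊗ ρ` of the
algebraic tensor product `C ⊗ D`, determined by `c ⊗ d ↦ π c ⊗ ρ d`. The operators act on the
algebraic tensor product `H ⊗ K` with its Hilbert norm. This is a dense subspace of the Hilbert
space tensor product, so the operator norms are the same as on the latter. -/
noncomputable def tensorRep (π : C →⋆ₙₐ[ℂ] (H →L[ℂ] H)) (ρ : D →⋆ₙₐ[ℂ] (K →L[ℂ] K)) :
    C ⊗[ℂ] D →ₗ[ℂ] ((H ⊗[ℂ] K) →L[ℂ] (H ⊗[ℂ] K)) :=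
  TensorProduct.lift <| LinearMap.mk₂ ℂ (fun c d ↦ TensorProduct.mapL (π c) (ρ d))
    (fun c c' d ↦ by simp [TensorProduct.mapL_add_left])
    (fun z c d ↦ by simp [TensorProduct.mapL_smul_left])
    (fun c d d' ↦ by simp [TensorProduct.mapL_add_right])
    (fun z c d ↦ by simp [TensorProduct.mapL_smul_right])

@[simp] theorem tensorRep_tmul (π : C →⋆ₙₐ[ℂ] (H →L[ℂ] H)) (ρ : D →⋆ₙₐ[ℂ] (K →L[ℂ] K))
    (c : C) (d : D) :
    tensorRep π ρ (c ⊗ₜ[ℂ] d) = TensorProduct.mapL (π c) (ρ d) := rfl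

theorem norm_tensorRep_tmul_le (π : C →⋆ₙₐ[ℂ] (H →L[ℂ] H)) (ρ : D →⋆ₙₐ[ℂ] (K →L[ℂ] K))
    (c : C) (d : D) : ‖tensorRep π ρ (c ⊗ₜ[ℂ] d)‖ ≤ ‖c‖ * ‖d‖ := by
  rw [tensorRep_tmul]
  refine (TensorProduct.norm_mapL_le _ _).trans ?_
  gcongr
  · exact NonUnitalStarAlgHom.norm_apply_le π c
  · exact NonUnitalStarAlgHom.norm_apply_le ρ d

end Representations

section MinNorm

variable {C : Type u} [NonUnitalCStarAlgebra C] {D : Type v} [NonUnitalCStarAlgebra D]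

/-- The set of all the norms `‖(π ⊗ ρ) x‖`, where `π` and `ρ` run through the representations of
`C` and `D` on Hilbert spaces. (Hilbert spaces in the universes of `C` and `D` suffice:
all GNS spaces and the direct sums of families of GNS spaces indexed by states lie there.) -/
def repNorms (x : C ⊗[ℂ] D) : Set ℝ :=
  {r | ∃ (H : Type u) (_ : NormedAddCommGroup H) (_ : InnerProductSpace ℂ H) (_ : CompleteSpace H)
      (K : Type v) (_ : NormedAddCommGroup K) (_ : InnerProductSpace ℂ K) (_ : CompleteSpace K)
      (π : C →⋆ₙₐ[ℂ] (H →L[ℂ] H)) (ρ : D →⋆ₙₐ[ℂ] (K →L[ℂ] K)), r = ‖tensorRep π ρ x‖}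

/-- The minimal (spatial) C*-norm on the algebraic tensor product `C ⊗ D`:
`‖x‖_min = sup ‖(π ⊗ ρ) x‖` over all representations `π` of `C` and `ρ` of `D`. -/
noncomputable def minNorm (x : C ⊗[ℂ] D) : ℝ := sSup (repNorms x)

theorem repNorms_nonempty (x : C ⊗[ℂ] D) : (repNorms x).Nonempty :=
  ⟨_, PUnit, inferInstance, inferInstance, inferInstance, PUnit, inferInstance, inferInstance,
    inferInstance, 0, 0, rfl⟩

theorem repNorms_bddAbove (x : C ⊗[ℂ] D) : BddAbove (repNorms x) := by
  suffices h : ∃ M : ℝ, ∀ r ∈ repNorms x, r ≤ M from h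
  induction x with
  | zero =>
    refine ⟨0, ?_⟩
    rintro r ⟨H, _, _, _, K, _, _, _, π, ρ, rfl⟩
    rw [map_zero]
    exact ContinuousLinearMap.opNorm_zero.le
  | tmul c d =>
    refine ⟨‖c‖ * ‖d‖, ?_⟩
    rintro r ⟨H, _, _, _, K, _, _, _, π, ρ, rfl⟩
    exact norm_tensorRep_tmul_le π ρ c d
  | add x y hx hy =>
    obtain ⟨M, hM⟩ := hx
    obtain ⟨N, hN⟩ := hy
    refine ⟨M + N, ?_⟩
    rintro r ⟨H, _, _, _, K, _, _, _, π, ρ, rfl⟩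
    rw [map_add]
    exact (ContinuousLinearMap.opNorm_add_le _ _).trans (add_le_add
      (hM _ ⟨H, _, _, inferInstance, K, _, _, inferInstance, π, ρ, rfl⟩)
      (hN _ ⟨H, _, _, inferInstance, K, _, _, inferInstance, π, ρ, rfl⟩))

theorem minNorm_nonneg (x : C ⊗[ℂ] D) : 0 ≤ minNorm x := by
  apply Real.sSup_nonneg
  rintro r ⟨H, _, _, _, K, _, _, _, π, ρ, rfl⟩
  exact ContinuousLinearMap.opNorm_nonneg _

theorem minNorm_add_le (x y : C ⊗[ℂ] D) : minNorm (x + y) ≤ minNorm x + minNorm y := by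
  apply csSup_le (repNorms_nonempty _)
  rintro r ⟨H, _, _, _, K, _, _, _, π, ρ, rfl⟩
  rw [map_add]
  exact (ContinuousLinearMap.opNorm_add_le _ _).trans (add_le_add
    (le_csSup (repNorms_bddAbove x) ⟨H, _, _, inferInstance, K, _, _, inferInstance, π, ρ, rfl⟩)
    (le_csSup (repNorms_bddAbove y) ⟨H, _, _, inferInstance, K, _, _, inferInstance, π, ρ, rfl⟩))

theorem minNorm_smul_le (z : ℂ) (x : C ⊗[ℂ] D) : minNorm (z • x) ≤ ‖z‖ * minNorm x := by
  apply csSup_le (repNorms_nonempty _)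
  rintro r ⟨H, _, _, _, K, _, _, _, π, ρ, rfl⟩
  rw [map_smul]
  refine (ContinuousLinearMap.opNorm_smul_le _ _).trans ?_
  exact mul_le_mul_of_nonneg_left (le_csSup (repNorms_bddAbove x)
    ⟨H, _, _, inferInstance, K, _, _, inferInstance, π, ρ, rfl⟩) (norm_nonneg z)

/-- The minimal norm, as a seminorm on the algebraic tensor product. -/
noncomputable def minSeminorm : Seminorm ℂ (C ⊗[ℂ] D) :=
  Seminorm.ofSMulLE minNorm
    (le_antisymm (by simpa using minNorm_smul_le (0 : ℂ) (0 : C ⊗[ℂ] D)) (minNorm_nonneg _))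
    minNorm_add_le minNorm_smul_le

end MinNorm

section MinTensor

/-- The algebraic tensor product `C ⊗ D`, as a type that carries the minimal norm. -/
def AlgTensor (C : Type u) (D : Type v) [NonUnitalCStarAlgebra C] [NonUnitalCStarAlgebra D] :
    Type (max u v) := C ⊗[ℂ] D

variable (C : Type u) (D : Type v) [NonUnitalCStarAlgebra C] [NonUnitalCStarAlgebra D]

noncomputable instance : AddCommGroup (AlgTensor C D) := inferInstanceAs (AddCommGroup (C ⊗[ℂ] D))

noncomputable instance : Module ℂ (AlgTensor C D) := inferInstanceAs (Module ℂ (C ⊗[ℂ] D))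

noncomputable instance : Norm (AlgTensor C D) := ⟨fun x ↦ minNorm (C := C) (D := D) x⟩

theorem algTensor_core : SeminormedSpace.Core ℂ (AlgTensor C D) where
  norm_nonneg x := minNorm_nonneg (C := C) (D := D) x
  norm_smul z x := map_smul_eq_mul (minSeminorm (C := C) (D := D)) z x
  norm_triangle x y := minNorm_add_le (C := C) (D := D) x y

noncomputable instance : SeminormedAddCommGroup (AlgTensor C D) :=
  SeminormedAddCommGroup.ofCore (algTensor_core C D)

noncomputable instance : NormedSpace ℂ (AlgTensor C D) where
  norm_smul_le z x := ((algTensor_core C D).norm_smul z x).le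

/-- The minimal tensor product `C ⊗min D` (as a Banach space, which is all that the distance
between subspaces sees): the completion of the algebraic tensor product in the minimal norm. -/
abbrev MinTensor : Type (max u v) := UniformSpace.Completion (AlgTensor C D)

variable {C D}

/-- The elementary tensor `c ⊗ d` in `C ⊗min D`. -/
noncomputable def elemTensor (c : C) (d : D) : MinTensor C D :=
  UniformSpace.Completion.coe' (show AlgTensor C D from c ⊗ₜ[ℂ] d)

variable (D) in
/-- For a C*-subalgebra `A` of `C`, the subspace `A ⊗min D` of `C ⊗min D`: the closed linear span
of the elementary tensors `a ⊗ d` with `a ∈ A` and `d ∈ D`. -/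
noncomputable def minTensorSub (A : NonUnitalStarSubalgebra ℂ C) : Submodule ℂ (MinTensor C D) :=
  (Submodule.span ℂ {z | ∃ a ∈ A, ∃ d : D, z = elemTensor a d}).topologicalClosure

/-- The underlying linear subspace of a star subalgebra. -/
def asSubmodule (A : NonUnitalStarSubalgebra ℂ C) : Submodule ℂ C :=
  A.toNonUnitalSubalgebra.toSubmodule

end MinTensor

end KadisonKastler

/-! Heuristically, `D` is `C₀(X)` and `C ⊗min D` is `C₀(X, C)`, so an element of the unit ball of `A
⊗min D` is a function with values in the unit ball of `A`. Replace finitely many of its values by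
nearby elements of the unit ball of `B` and glue them with a partition of unity: the error of the
gluing is no worse than the pointwise error.

Three facts make this precise without identifying the tensor product. Slicing by a character is
contractive for the minimal norm (`norm_slice_le_minNorm`), so "values" of a contraction are
contractions. Gluing `(bᵢ) ↦ ∑ bᵢ ⊗ sᵢ* sᵢ` is contractive for the sup norm
(`minNorm_sum_tmul_star_mul_le`); this serves both to bound the new element and to bound the error.
Finally, the identity of `D` is approximated on finite sets by `d ↦ ∑ χᵢ(d) sᵢ* sᵢ`
(`exists_character_approx`).

For the reverse inequality with a unit `e`, embed by `a ↦ a ⊗ e`, approximate there, and return by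
slicing at a character with `χ e = 1`; both maps are contractive. -/

namespace KadisonKastler

/-! ### States and the GNS construction: representations that norm a given element. -/

section Norming

open scoped ComplexOrder

section State

variable {A : Type u} [CStarAlgebra A] [Nontrivial A]

/-- Translating `x` by `it` shifts the imaginary part of `φ x` by `t`, while the C*-identity lets
the squared norm grow only by `t²`; the cross term linear in `t` must then vanish. -/
theorem im_apply_eq_zero_of_isSelfAdjoint {φ : A →L[ℂ] ℂ} (hφ : ‖φ‖ ≤ 1) (h1 : φ 1 = 1)
    {x : A} (hx : IsSelfAdjoint x) : (φ x).im = 0 := by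
  have key (t : ℝ) : ((φ x).im + t) ^ 2 ≤ ‖x‖ ^ 2 + t ^ 2 := by
    have h2 : ‖x + ((t : ℂ) * Complex.I) • (1 : A)‖ ^ 2 ≤ ‖x‖ ^ 2 + t ^ 2 := by
      rw [sq, ← CStarRing.norm_star_mul_self]
      have : star (x + ((t : ℂ) * Complex.I) • (1 : A)) * (x + ((t : ℂ) * Complex.I) • (1 : A))
          = x * x + ((t ^ 2 : ℝ) : ℂ) • (1 : A) := by
        simp only [star_add, star_smul, hx.star_eq, star_one, add_mul, mul_add, smul_mul_assoc,
          mul_smul_comm, one_mul, mul_one, RCLike.star_def, map_mul, Complex.conj_ofReal,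
          Complex.conj_I]
        have e : ((t ^ 2 : ℝ) : ℂ) = (t : ℂ) * Complex.I * (t * -Complex.I) := by
          push_cast
          linear_combination (t : ℂ) ^ 2 * Complex.I_sq
        rw [e]
        module
      rw [this]
      refine (norm_add_le _ _).trans (add_le_add ((norm_mul_le _ _).trans_eq (sq _).symm) ?_)
      rw [norm_smul, Complex.norm_real, Real.norm_of_nonneg (sq_nonneg t)]
      simp
    refine le_trans ?_ h2
    have h3 : ‖φ (x + ((t : ℂ) * Complex.I) • (1 : A))‖ ≤
        ‖x + ((t : ℂ) * Complex.I) • (1 : A)‖ := by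
      simpa using φ.le_of_opNorm_le hφ (x + ((t : ℂ) * Complex.I) • (1 : A))
    have h4 := (Complex.abs_im_le_norm _).trans h3
    simp only [map_add, map_smul, h1, smul_eq_mul, mul_one, Complex.add_im, Complex.mul_im,
      Complex.ofReal_re, Complex.I_im, Complex.ofReal_im, Complex.I_re] at h4
    rw [← sq_abs]
    refine pow_le_pow_left₀ (abs_nonneg _) ?_ 2
    simpa using h4
  by_contra h
  -- This `t` makes the cross term `2 (φ x).im t` equal to `2‖x‖² + 2`, which exceeds the allowed
  -- `‖x‖²`.
  have := key ((‖x‖ ^ 2 + 1) / (φ x).im)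
  have e : (φ x).im * ((‖x‖ ^ 2 + 1) / (φ x).im) = ‖x‖ ^ 2 + 1 := by field_simp
  nlinarith [sq_nonneg (φ x).im, sq_nonneg ‖x‖]

variable [PartialOrder A] [StarOrderedRing A]

/-- For positive `x` the element `‖x‖ - x` has norm at most `‖x‖`, so the real part of `‖x‖ - φ x`
is at most `‖x‖`. -/
theorem apply_nonneg_of_map_one {φ : A →L[ℂ] ℂ} (hφ : ‖φ‖ ≤ 1) (h1 : φ 1 = 1)
    {x : A} (hx : 0 ≤ x) : 0 ≤ φ x := by
  rw [Complex.nonneg_iff]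
  refine ⟨?_, (im_apply_eq_zero_of_isSelfAdjoint hφ h1 (.of_nonneg hx)).symm⟩
  have h2 : ‖algebraMap ℝ A ‖x‖ - x‖ ≤ ‖x‖ := by
    have h0 : 0 ≤ algebraMap ℝ A ‖x‖ - x :=
      sub_nonneg.mpr (IsSelfAdjoint.le_algebraMap_norm_self (.of_nonneg hx))
    rw [CStarAlgebra.norm_le_iff_le_algebraMap _ (norm_nonneg x) h0]
    exact sub_le_self _ hx
  have h3 := (Complex.re_le_norm _).trans (φ.le_of_opNorm_le hφ (algebraMap ℝ A ‖x‖ - x))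
  have h4 : algebraMap ℝ A ‖x‖ = (‖x‖ : ℂ) • (1 : A) := by
    rw [Algebra.algebraMap_eq_smul_one, Complex.coe_smul]
  rw [map_sub, h4, map_smul, h1, ← h4] at h3
  simp at h3
  linarith

/-- Every positive element of a unital C⋆-algebra is normed by a state. -/
theorem exists_state_apply_eq_norm {a : A} (ha : 0 ≤ a) :
    ∃ φ : A →ₚ[ℂ] ℂ, φ 1 = 1 ∧ φ a = ‖a‖ := by
  have hn : 2 * ‖a‖ ≤ ‖(‖a‖ : ℂ) • (1 : A) + a‖ := by
    have h1 : ‖a‖ ∈ spectrum ℝ a := CStarAlgebra.norm_mem_spectrum_of_nonneg ha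
    have h2 : ‖a‖ + ‖a‖ ∈ spectrum ℝ (algebraMap ℝ A ‖a‖ + a) := by
      exact spectrum.add_mem_add_iff.mpr h1
    have h3 := spectrum.norm_le_norm_of_mem h2
    rw [Real.norm_of_nonneg (by positivity), Algebra.algebraMap_eq_smul_one,
      ← Complex.coe_smul] at h3
    linarith
  obtain ⟨φ, hφ, hφa⟩ : ∃ φ : A →L[ℂ] ℂ, ‖φ‖ ≤ 1 ∧ φ 1 = 1 ∧ φ a = ‖a‖ := by
    by_cases h0 : a = 0
    · obtain ⟨φ, h1, h2⟩ := exists_dual_vector ℂ (1 : A) (by simp)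
      exact ⟨φ, h1.le, by simpa using h2, by simp [h0]⟩
    have hpos : 0 < ‖a‖ := norm_pos_iff.mpr h0
    -- A functional norming `‖a‖ + a`, whose norm is at least `2‖a‖`, must be extremal at both
    -- summands; this gives `φ 1 = 1` and `φ a = ‖a‖` at once.
    obtain ⟨φ, h1, h2⟩ := exists_dual_vector ℂ ((‖a‖ : ℂ) • (1 : A) + a) (by
      linarith)
    have hle (x : A) : ‖φ x‖ ≤ ‖x‖ := by simpa using φ.le_of_opNorm_le h1.le x
    have hre : ‖a‖ * (φ 1).re + (φ a).re = ‖(‖a‖ : ℂ) • (1 : A) + a‖ := by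
      simpa using congrArg Complex.re h2
    have him : ‖a‖ * (φ 1).im + (φ a).im = 0 := by
      simpa using congrArg Complex.im h2
    have hone := hle 1
    rw [norm_one] at hone
    have hone' := (Complex.re_le_norm (φ 1)).trans hone
    have haa := (Complex.re_le_norm (φ a)).trans (hle a)
    have r1 : (φ 1).re = 1 := by nlinarith
    have i1 : (φ 1).im = 0 := by
      have := Complex.sq_norm_sub_sq_re (φ 1)
      have := norm_nonneg (φ 1)
      nlinarith [sq_nonneg (φ 1).im]
    refine ⟨φ, h1.le, Complex.ext r1 i1, Complex.ext ?_ ?_⟩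
    · simp only [Complex.ofReal_re]
      nlinarith
    · simpa [i1] using him
  exact ⟨PositiveLinearMap.mk₀ φ.toLinearMap fun x hx ↦ apply_nonneg_of_map_one hφ hφa.1 hx, hφa⟩

end State

open scoped CStarAlgebra in
/-- Every element of a C⋆-algebra attains its norm in some representation. -/
theorem exists_rep_norm_le {C : Type u} [NonUnitalCStarAlgebra C] (c : C) :
    ∃ (H : Type u) (_ : NormedAddCommGroup H) (_ : InnerProductSpace ℂ H) (_ : CompleteSpace H)
      (π : C →⋆ₙₐ[ℂ] (H →L[ℂ] H)), ‖c‖ ≤ ‖π c‖ := by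
  let _ := CStarAlgebra.spectralOrder (Unitization ℂ C)
  let _ := CStarAlgebra.spectralOrderedRing (Unitization ℂ C)
  obtain ⟨φ, h1, h2⟩ := exists_state_apply_eq_norm
    (star_mul_self_nonneg (Unitization.inr c : Unitization ℂ C))
  refine ⟨φ.GNS, inferInstance, inferInstance, inferInstance,
    φ.gnsNonUnitalStarAlgHom.comp (Unitization.inrNonUnitalStarAlgHom ℂ C), ?_⟩
  set π := φ.gnsNonUnitalStarAlgHom.comp (Unitization.inrNonUnitalStarAlgHom ℂ C)
  -- The cyclic vector is a unit vector, and `π c` sends it to a vector of squared norm `φ (c* c) =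
  -- ‖c‖²`.
  have hξ : ‖((φ.toPreGNS 1 : φ.PreGNS) : φ.GNS)‖ = 1 := by
    rw [UniformSpace.Completion.norm_coe, PositiveLinearMap.preGNS_norm_def]
    simp [h1]
  have hc : ‖π c ((φ.toPreGNS 1 : φ.PreGNS) : φ.GNS)‖ = ‖c‖ := by
    have : π c ((φ.toPreGNS 1 : φ.PreGNS) : φ.GNS) =
        ((φ.toPreGNS (Unitization.inr c) : φ.PreGNS) : φ.GNS) := by
      simp [π]
    rw [this, UniformSpace.Completion.norm_coe, PositiveLinearMap.preGNS_norm_def]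
    simp only [PositiveLinearMap.ofPreGNS_toPreGNS]
    rw [h2, CStarRing.norm_star_mul_self, Unitization.norm_inr, Complex.ofReal_re,
      Real.sqrt_mul_self (norm_nonneg _)]
  simpa [hξ, hc] using (π c).le_opNorm ((φ.toPreGNS 1 : φ.PreGNS) : φ.GNS)

end Norming

/-! ### Contractivity of slicing and of gluing for the minimal norm. -/

section Estimates

variable {C : Type u} [NonUnitalCStarAlgebra C] {D : Type v} [NonUnitalCStarAlgebra D]

theorem norm_tensorRep_le_minNorm {H : Type u} [NormedAddCommGroup H] [InnerProductSpace ℂ H]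
    [CompleteSpace H] {K : Type v} [NormedAddCommGroup K] [InnerProductSpace ℂ K] [CompleteSpace K]
    (π : C →⋆ₙₐ[ℂ] (H →L[ℂ] H)) (ρ : D →⋆ₙₐ[ℂ] (K →L[ℂ] K)) (x : C ⊗[ℂ] D) :
    ‖tensorRep π ρ x‖ ≤ minNorm x :=
  le_csSup (repNorms_bddAbove x) ⟨H, _, _, inferInstance, K, _, _, inferInstance, π, ρ, rfl⟩

theorem minNorm_tmul_le (c : C) (d : D) : minNorm (c ⊗ₜ[ℂ] d) ≤ ‖c‖ * ‖d‖ := by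
  apply csSup_le (repNorms_nonempty _)
  rintro r ⟨H, _, _, _, K, _, _, _, π, ρ, rfl⟩
  exact norm_tensorRep_tmul_le π ρ c d

/-- The right slice map `id ⊗ χ` on the algebraic tensor product. -/
noncomputable def slice (χ : D →⋆ₙₐ[ℂ] ℂ) : C ⊗[ℂ] D →ₗ[ℂ] C :=
  (TensorProduct.rid ℂ C).toLinearMap ∘ₗ TensorProduct.map LinearMap.id (χ : D →ₗ[ℂ] ℂ)

@[simp] theorem slice_tmul (χ : D →⋆ₙₐ[ℂ] ℂ) (c : C) (d : D) :
    slice χ (c ⊗ₜ[ℂ] d) = χ d • c := by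
  simp [slice]

/-- The action of `D` by scalars on a Hilbert space through a character. -/
noncomputable def scalarRep (K : Type*) [NormedAddCommGroup K] [InnerProductSpace ℂ K]
    [CompleteSpace K] (χ : D →⋆ₙₐ[ℂ] ℂ) : D →⋆ₙₐ[ℂ] (K →L[ℂ] K) where
  toFun d := χ d • ContinuousLinearMap.id ℂ K
  map_smul' z d := by simp [smul_smul]
  map_zero' := by simp
  map_add' d d' := by simp [add_smul]
  map_mul' d d' := by ext; simp [smul_smul, mul_comm]
  map_star' d := by
    rw [map_star, star_smul]
    congr 1
    exact (star_one (K →L[ℂ] K)).symm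

theorem tensorRep_scalarRep {H : Type*} [NormedAddCommGroup H] [InnerProductSpace ℂ H]
    [CompleteSpace H] {K : Type*} [NormedAddCommGroup K] [InnerProductSpace ℂ K] [CompleteSpace K]
    (π : C →⋆ₙₐ[ℂ] (H →L[ℂ] H)) (χ : D →⋆ₙₐ[ℂ] ℂ) (x : C ⊗[ℂ] D) :
    tensorRep π (scalarRep K χ) x =
      TensorProduct.mapL (π (slice χ x)) (ContinuousLinearMap.id ℂ K) := by
  induction x with
  | zero => simp
  | tmul c d =>
    rw [tensorRep_tmul, slice_tmul, map_smul, TensorProduct.mapL_smul_left]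
    exact TensorProduct.mapL_smul_right ..
  | add x y hx hy => rw [map_add, map_add, map_add, TensorProduct.mapL_add_left, hx, hy]

/-- Slice maps at characters are contractive for the minimal norm. -/
theorem norm_slice_le_minNorm (χ : D →⋆ₙₐ[ℂ] ℂ) (x : C ⊗[ℂ] D) :
    ‖slice χ x‖ ≤ minNorm x := by
  obtain ⟨H, _, _, _, π, hπ⟩ := exists_rep_norm_le (slice χ x)
  -- The second representation acts by `χ` on a one-dimensional space, so `π ⊗ ρ` is in effect `π`
  -- applied to the slice. The space is placed in the universe over which `repNorms` ranges.
  refine hπ.trans (le_trans ?_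
    (norm_tensorRep_le_minNorm π (scalarRep (EuclideanSpace ℂ PUnit.{v + 1}) χ) x))
  rw [tensorRep_scalarRep]
  refine ContinuousLinearMap.opNorm_le_bound _ (ContinuousLinearMap.opNorm_nonneg _) fun ξ ↦ ?_
  let k : EuclideanSpace ℂ PUnit.{v + 1} := EuclideanSpace.single PUnit.unit 1
  have hk : ‖k‖ = 1 := by simp [k]
  have := (TensorProduct.mapL (π (slice χ x))
    (ContinuousLinearMap.id ℂ (EuclideanSpace ℂ PUnit.{v + 1}))).le_opNorm (ξ ⊗ₜ[ℂ] k)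
  rw [TensorProduct.mapL_tmul, TensorProduct.norm_tmul, TensorProduct.norm_tmul] at this
  simpa [hk] using this

section Hilbert

theorem mapL_sum_right {H : Type*} [NormedAddCommGroup H] [InnerProductSpace ℂ H]
    {K : Type*} [NormedAddCommGroup K] [InnerProductSpace ℂ K] {ι : Type*}
    (t : Finset ι) (T : H →L[ℂ] H) (S : ι → K →L[ℂ] K) :
    TensorProduct.mapL T (∑ i ∈ t, S i) = ∑ i ∈ t, TensorProduct.mapL T (S i) := by
  classical
  induction t using Finset.induction_on with
  | empty => simp
  | insert i t hi ih =>
    rw [Finset.sum_insert hi, Finset.sum_insert hi, TensorProduct.mapL_add_right, ih]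

variable {H : Type*} [NormedAddCommGroup H] [InnerProductSpace ℂ H] [CompleteSpace H]
variable {K : Type*} [NormedAddCommGroup K] [InnerProductSpace ℂ K] [CompleteSpace K]

theorem inner_mapL_star (T : H →L[ℂ] H) (S : K →L[ℂ] K) (x y : H ⊗[ℂ] K) :
    inner ℂ (TensorProduct.mapL (star T) (star S) x) y =
      inner ℂ x (TensorProduct.mapL T S y) := by
  induction x with
  | zero => simp
  | add x x' hx hx' => rw [map_add, inner_add_left, inner_add_left, hx, hx']
  | tmul h k =>
    induction y with
    | zero => simp
    | add y y' hy hy' => rw [map_add, inner_add_right, inner_add_right, hy, hy']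
    | tmul h' k' =>
      simp [ContinuousLinearMap.star_eq_adjoint,
        ContinuousLinearMap.adjoint_inner_left]

/-- Factor `T ⊗ S*S = (1 ⊗ S*)(T ⊗ 1)(1 ⊗ S)`. This symmetric form is why the gluing weights are
written `sᵢ* sᵢ`. -/
theorem inner_mapL_star_mul (T : H →L[ℂ] H) (S : K →L[ℂ] K) (ξ η : H ⊗[ℂ] K) :
    inner ℂ η (TensorProduct.mapL T (star S * S) ξ) =
      inner ℂ (TensorProduct.mapL 1 S η)
        (TensorProduct.mapL T 1 (TensorProduct.mapL 1 S ξ)) := by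
  have h1 : TensorProduct.mapL T (star S * S) =
      TensorProduct.mapL 1 (star S) * (TensorProduct.mapL T 1 * TensorProduct.mapL 1 S) := by
    simp [← TensorProduct.mapL_mul]
  rw [h1, mul_apply_eq_comp, mul_apply_eq_comp]
  have := inner_mapL_star (1 : H →L[ℂ] H) (star S) η
    (TensorProduct.mapL T 1 (TensorProduct.mapL 1 S ξ))
  rw [star_one, star_star] at this
  exact this.symm

/-- The left side is `⟨ξ, (1 ⊗ ∑ Sᵢ*Sᵢ) ξ⟩`: the column with entries `1 ⊗ Sᵢ` is a contraction. -/
theorem sum_norm_mapL_sq_le {ι : Type*} (t : Finset ι) (S : ι → K →L[ℂ] K)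
    (hS : ‖∑ i ∈ t, star (S i) * S i‖ ≤ 1) (ξ : H ⊗[ℂ] K) :
    ∑ i ∈ t, ‖TensorProduct.mapL (1 : H →L[ℂ] H) (S i) ξ‖ ^ 2 ≤ ‖ξ‖ ^ 2 := by
  have h1 : (∑ i ∈ t, (‖TensorProduct.mapL (1 : H →L[ℂ] H) (S i) ξ‖ : ℂ) ^ 2) =
      inner ℂ ξ (TensorProduct.mapL (1 : H →L[ℂ] H) (∑ i ∈ t, star (S i) * S i) ξ) := by
    rw [mapL_sum_right, sum_apply, inner_sum]
    refine Finset.sum_congr rfl fun i _ ↦ ?_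
    have h3 : TensorProduct.mapL (1 : H →L[ℂ] H) (1 : K →L[ℂ] K) = 1 := TensorProduct.mapL_id_id
    rw [inner_mapL_star_mul, h3, one_apply_eq_self]
    exact (inner_self_eq_norm_sq_to_K (𝕜 := ℂ) (E := H ⊗[ℂ] K) _).symm
  have h4 : ∑ i ∈ t, ‖TensorProduct.mapL (1 : H →L[ℂ] H) (S i) ξ‖ ^ 2 =
      ‖(inner ℂ ξ (TensorProduct.mapL (1 : H →L[ℂ] H) (∑ i ∈ t, star (S i) * S i) ξ) : ℂ)‖ := by
    rw [← h1]
    norm_cast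
    rw [Real.norm_of_nonneg (by positivity)]
  rw [h4, sq]
  refine (norm_inner_le_norm (𝕜 := ℂ) (E := H ⊗[ℂ] K) _ _).trans ?_
  gcongr
  have h5 := (TensorProduct.norm_mapL_le (1 : H →L[ℂ] H) (∑ i ∈ t, star (S i) * S i)).trans
    (mul_le_one₀ ContinuousLinearMap.norm_id_le (norm_nonneg _) hS)
  simpa using ContinuousLinearMap.le_of_opNorm_le _ h5 ξ

/-- Positive combinations of contractions are contractions. -/
theorem norm_sum_mapL_le {ι : Type*} (t : Finset ι) (T : ι → H →L[ℂ] H) (S : ι → K →L[ℂ] K)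
    {M : ℝ} (hM : 0 ≤ M) (hT : ∀ i ∈ t, ‖T i‖ ≤ M) (hS : ‖∑ i ∈ t, star (S i) * S i‖ ≤ 1) :
    ‖∑ i ∈ t, TensorProduct.mapL (T i) (star (S i) * S i)‖ ≤ M := by
  refine ContinuousLinearMap.opNorm_le_bound _ hM fun ξ ↦ ?_
  set V : ι → (H ⊗[ℂ] K) →L[ℂ] (H ⊗[ℂ] K) := fun i ↦ TensorProduct.mapL 1 (S i)
  -- Cauchy–Schwarz, first for each term in the Hilbert space and then for the sum over `i`, with
  -- the column contraction bounding both factors. Taking `η` to be the image vector gives the norm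
  -- bound.
  have key (η : H ⊗[ℂ] K) :
      ‖(inner ℂ η ((∑ i ∈ t, TensorProduct.mapL (T i) (star (S i) * S i)) ξ) : ℂ)‖ ≤
        ‖η‖ * (M * ‖ξ‖) := by
    rw [sum_apply, inner_sum]
    calc _ ≤ ∑ i ∈ t, M * (‖V i η‖ * ‖V i ξ‖) := by
          refine norm_sum_le_of_le _ fun i hi ↦ ?_
          rw [inner_mapL_star_mul]
          have h1 : ‖TensorProduct.mapL (T i) (1 : K →L[ℂ] K)‖ ≤ M := by
            refine (TensorProduct.norm_mapL_le _ _).trans ?_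
            have : ‖(1 : K →L[ℂ] K)‖ ≤ 1 := ContinuousLinearMap.norm_id_le
            nlinarith [hT i hi, norm_nonneg (T i)]
          refine (norm_inner_le_norm (𝕜 := ℂ) _ _).trans ?_
          have := ContinuousLinearMap.le_of_opNorm_le _ h1 (V i ξ)
          calc _ ≤ ‖V i η‖ * (M * ‖V i ξ‖) := by gcongr
            _ = _ := by ring
      _ = M * ∑ i ∈ t, ‖V i η‖ * ‖V i ξ‖ := by rw [Finset.mul_sum]
      _ ≤ M * (‖η‖ * ‖ξ‖) := by
          gcongr
          refine (Real.sum_mul_le_sqrt_mul_sqrt t _ _).trans ?_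
          gcongr
          · exact Real.sqrt_le_iff.mpr ⟨norm_nonneg _, sum_norm_mapL_sq_le t S hS η⟩
          · exact Real.sqrt_le_iff.mpr ⟨norm_nonneg _, sum_norm_mapL_sq_le t S hS ξ⟩
      _ = _ := by ring
  set ζ := (∑ i ∈ t, TensorProduct.mapL (T i) (star (S i) * S i)) ξ
  have h2 := key ζ
  rw [inner_self_eq_norm_sq_to_K (𝕜 := ℂ) ζ, norm_pow, RCLike.norm_ofReal, abs_norm, sq] at h2
  rcases (norm_nonneg ζ).eq_or_lt with h0 | h0
  · rw [← h0]
    positivity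
  · exact le_of_mul_le_mul_left h2 h0

end Hilbert

/-- The minimal norm of `∑ bᵢ ⊗ sᵢ* sᵢ` is at most `max ‖bᵢ‖` when `‖∑ sᵢ* sᵢ‖ ≤ 1`. -/
theorem minNorm_sum_tmul_star_mul_le {ι : Type*} (t : Finset ι) (b : ι → C) (s : ι → D)
    {M : ℝ} (hM : 0 ≤ M) (hb : ∀ i ∈ t, ‖b i‖ ≤ M) (hs : ‖∑ i ∈ t, star (s i) * s i‖ ≤ 1) :
    minNorm (∑ i ∈ t, b i ⊗ₜ[ℂ] (star (s i) * s i)) ≤ M := by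
  apply csSup_le (repNorms_nonempty _)
  rintro r ⟨H, _, _, _, K, _, _, _, π, ρ, rfl⟩
  simp only [map_sum, tensorRep_tmul, map_mul, map_star]
  refine norm_sum_mapL_le t (fun i ↦ π (b i)) (fun i ↦ ρ (s i)) hM
    (fun i hi ↦ (NonUnitalStarAlgHom.norm_apply_le π _).trans (hb i hi)) ?_
  have := (NonUnitalStarAlgHom.norm_apply_le ρ (∑ i ∈ t, star (s i) * s i)).trans hs
  simpa only [map_sum, map_mul, map_star] using this

end Estimates

/-! ### Gelfand duality and partitions of unity. -/

section PartitionOfUnity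

open WeakDual

/-- Finitely many continuous functions on a compact space are approximated simultaneously by
means of a quadratic partition of unity and point evaluations. -/
theorem _root_.ContinuousMap.exists_quadratic_partition {X : Type*} [TopologicalSpace X]
    [CompactSpace X] [T2Space X] {κ : Type*} [Finite κ] (f : κ → C(X, ℂ)) {ε : ℝ} (hε : 0 < ε) :
    ∃ (t : Finset X) (q : t → C(X, ℂ)), ∑ i, star (q i) * q i = 1 ∧
      ∀ j, ‖f j - ∑ i : t, f j i • (star (q i) * q i)‖ ≤ ε := by
  let U : X → Set X := fun x ↦ {y | ∀ j, ‖f j y - f j x‖ < ε}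
  have hU (x : X) : IsOpen (U x) := by
    simp only [U, Set.ofPred_forall]
    exact isOpen_iInter_of_finite fun j ↦ isOpen_lt (by fun_prop) continuous_const
  obtain ⟨t, ht⟩ := isCompact_univ.elim_finite_subcover U hU
    fun x _ ↦ Set.mem_iUnion.mpr ⟨x, fun j ↦ by simpa using hε⟩
  obtain ⟨g, hg⟩ := PartitionOfUnity.exists_isSubordinate isClosed_univ (fun i : t ↦ U i)
    (fun i ↦ hU i) (by simpa [Set.iUnion_subtype] using ht)
  have hsum (y : X) : ∑ i, g i y = 1 := by
    rw [← finsum_eq_sum_of_fintype]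
    exact g.sum_eq_one (Set.mem_univ y)
  -- Square roots turn the partition functions into the form `qᵢ* qᵢ`.
  let q : t → C(X, ℂ) := fun i ↦ ⟨fun y ↦ ((√(g i y) : ℝ) : ℂ), by fun_prop⟩
  have hq (i : t) (y : X) : (star (q i) * q i) y = (g i y : ℂ) := by
    simp only [q, ContinuousMap.mul_apply, ContinuousMap.star_apply, ContinuousMap.coe_mk,
      RCLike.star_def, Complex.conj_ofReal]
    rw [← Complex.ofReal_mul, Real.mul_self_sqrt (g.nonneg i y)]
  refine ⟨t, q, ?_, fun j ↦ ?_⟩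
  · ext y
    rw [ContinuousMap.sum_apply]
    simp only [hq, ContinuousMap.one_apply]
    exact_mod_cast hsum y
  · rw [ContinuousMap.norm_le _ hε.le]
    intro y
    have h1 : (f j - ∑ i : t, f j i • (star (q i) * q i)) y =
        ∑ i : t, (g i y : ℂ) * (f j y - f j i) := by
      simp only [ContinuousMap.sub_apply, ContinuousMap.sum_apply, ContinuousMap.smul_apply, hq,
        mul_sub, Finset.sum_sub_distrib, ← Finset.sum_mul, smul_eq_mul]
      rw [← Complex.ofReal_sum, hsum, Complex.ofReal_one, one_mul]
      simp only [mul_comm]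
    rw [h1]
    calc _ ≤ ∑ i : t, g i y * ε := by
          refine norm_sum_le_of_le _ fun i _ ↦ ?_
          rw [norm_mul, Complex.norm_real, Real.norm_of_nonneg (g.nonneg i y)]
          by_cases h0 : g i y = 0
          · simp [h0]
          · have : y ∈ U i := hg i (subset_tsupport _ h0)
            exact mul_le_mul_of_nonneg_left (this j).le (g.nonneg i y)
      _ = ε := by rw [← Finset.sum_mul, hsum, one_mul]

theorem _root_.CommCStarAlgebra.exists_quadratic_partition {E : Type*} [CommCStarAlgebra E]
    {κ : Type*} [Finite κ] (x : κ → E) {ε : ℝ} (hε : 0 < ε) :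
    ∃ (t : Finset (characterSpace ℂ E)) (p : t → E), ∑ i, star (p i) * p i = 1 ∧
      ∀ j, ‖x j - ∑ i : t, i.1 (x j) • (star (p i) * p i)‖ ≤ ε := by
  obtain ⟨t, q, h1, h2⟩ :=
    ContinuousMap.exists_quadratic_partition (fun j ↦ gelfandTransform ℂ E (x j)) hε
  choose p hp using fun i ↦ (gelfandTransform_bijective E).2 (q i)
  refine ⟨t, p, ?_, fun j ↦ ?_⟩
  · apply (gelfandTransform_bijective E).1
    simpa only [map_sum, map_mul, map_one, gelfandTransform_map_star, hp] using h1
  · rw [← (gelfandTransform_isometry E).norm_map_of_map_zero (map_zero _)]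
    simp only [map_sub, map_sum, map_smul, map_mul, gelfandTransform_map_star, hp]
    exact h2 j

/-- The restriction to `D` of a character of its unitization. -/
noncomputable def restrictCharacter {D : Type*} [NonUnitalCommCStarAlgebra D]
    (ψ : characterSpace ℂ (Unitization ℂ D)) : D →⋆ₙₐ[ℂ] ℂ where
  toFun d := ψ (Unitization.inr d)
  map_smul' z d := by simp
  map_zero' := by simp
  map_add' d d' := by simp
  map_mul' d d' := by simp
  map_star' d := by rw [Unitization.inr_star, map_star]

/-- An approximate factorization of the identity of a commutative C⋆-algebra through `ℂⁿ`. -/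
theorem exists_character_approx {D : Type v} [NonUnitalCommCStarAlgebra D]
    {κ : Type*} [Finite κ] (d : κ → D) {ε : ℝ} (hε : 0 < ε) :
    ∃ (ι : Type v) (_ : Fintype ι) (χ : ι → D →⋆ₙₐ[ℂ] ℂ) (s : ι → D),
      ‖∑ i, star (s i) * s i‖ ≤ 1 ∧ ∀ j, ‖d j - ∑ i, χ i (d j) • (star (s i) * s i)‖ ≤ ε := by
  obtain ⟨t, p, h1, h2⟩ := CommCStarAlgebra.exists_quadratic_partition
    (fun j ↦ (Unitization.inr (d j) : Unitization ℂ D)) (half_pos hε)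
  obtain ⟨e, he1, he2, he3⟩ : ∃ e : D, ‖e‖ ≤ 1 ∧ star e = e ∧ ∀ j, ‖d j * e - d j‖ ≤ ε / 4 := by
    let _ := CStarAlgebra.spectralOrder D
    let _ := CStarAlgebra.spectralOrderedRing D
    have hl := CStarAlgebra.increasingApproximateUnit D
    have hev : ∀ᶠ e in CStarAlgebra.approximateUnit D, ∀ j, ‖d j * e - d j‖ ≤ ε / 4 := by
      rw [Filter.eventually_all]
      intro j
      have := (hl.tendsto_mul_left (d j)).eventually
        (Metric.closedBall_mem_nhds (d j) (by positivity : 0 < ε / 4))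
      simpa [dist_eq_norm] using this
    have := hl.neBot
    exact (hl.eventually_norm.and (hl.eventually_star_eq.and hev)).exists
  -- `D` is an ideal in its unitization, so `pᵢ e` lies in `D`. As `e` is self-adjoint and
  -- everything commutes, `sᵢ* sᵢ = pᵢ* pᵢ e²`, and these sum to `e²`.
  let s : t → D := fun i ↦ (p i).fst • e + (p i).snd * e
  have hs (i : t) : (Unitization.inr (s i) : Unitization ℂ D) = p i * Unitization.inr e := by
    ext <;> simp [s]
  have hss (i : t) : (Unitization.inr (star (s i) * s i) : Unitization ℂ D) =
      star (p i) * p i * Unitization.inr (e * e) := by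
    rw [Unitization.inr_mul, Unitization.inr_star, hs, star_mul, ← Unitization.inr_star, he2,
      Unitization.inr_mul]
    ring
  refine ⟨t, inferInstance, fun i ↦ restrictCharacter i, s, ?_, fun j ↦ ?_⟩
  · rw [← Unitization.norm_inr (𝕜 := ℂ)]
    have : (Unitization.inr (∑ i, star (s i) * s i) : Unitization ℂ D) =
        Unitization.inr (e * e) := by
      rw [← Unitization.inrHom_apply ℂ, map_sum]
      simp only [Unitization.inrHom_apply, hss]
      rw [← Finset.sum_mul, h1, one_mul]
    rw [this, Unitization.norm_inr]
    exact (norm_mul_le _ _).trans (mul_le_one₀ he1 (norm_nonneg _) he1)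
  -- The error splits into `d - d e²`, small by the choice of `e`, and `e²` times the error in the
  -- unitization.
  · have h3 : (Unitization.inr (d j - ∑ i : t, restrictCharacter i.1 (d j) • (star (s i) * s i)) :
          Unitization ℂ D) = Unitization.inr (d j - d j * e * e) +
        (Unitization.inr (d j) - ∑ i : t, i.1
          (Unitization.inr (d j)) • (star (p i) * p i)) * Unitization.inr (e * e) := by
      have h5 : (Unitization.inr (∑ i : t, restrictCharacter i.1 (d j) • (star (s i) * s i)) :
          Unitization ℂ D) = (∑ i : t, i.1 (Unitization.inr (d j)) • (star (p i) * p i)) *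
            Unitization.inr (e * e) := by
        rw [← Unitization.inrHom_apply ℂ, map_sum, Finset.sum_mul]
        refine Finset.sum_congr rfl fun i _ ↦ ?_
        rw [map_smul, Unitization.inrHom_apply, hss, smul_mul_assoc]
        rfl
      rw [Unitization.inr_sub, h5, Unitization.inr_sub, Unitization.inr_mul, Unitization.inr_mul,
        Unitization.inr_mul]
      ring
    have hee : ‖e * e‖ ≤ 1 := (norm_mul_le _ _).trans (mul_le_one₀ he1 (norm_nonneg _) he1)
    have h4 : ‖d j - d j * e * e‖ ≤ ε / 2 := by
      have : d j - d j * e * e = -((d j * e - d j) * e) - (d j * e - d j) := by noncomm_ring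
      rw [this]
      refine (norm_sub_le _ _).trans ?_
      rw [norm_neg]
      have h5 := norm_mul_le (d j * e - d j) e
      nlinarith [he3 j, norm_nonneg (d j * e - d j)]
    rw [← Unitization.norm_inr (𝕜 := ℂ), h3]
    refine (norm_add_le _ _).trans ?_
    rw [Unitization.norm_inr]
    have h6 := norm_mul_le (Unitization.inr (d j) - ∑ i : t,
      i.1 (Unitization.inr (d j)) • (star (p i) * p i))
      (Unitization.inr (e * e) : Unitization ℂ D)
    rw [Unitization.norm_inr (𝕜 := ℂ) (a := e * e)] at h6
    have h7 := mul_le_mul (h2 j) hee (norm_nonneg _) (half_pos hε).le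
    linarith

theorem exists_character_apply_ne_zero {D : Type*} [NonUnitalCommCStarAlgebra D] {d : D}
    (hd : d ≠ 0) : ∃ χ : D →⋆ₙₐ[ℂ] ℂ, χ d ≠ 0 := by
  by_contra! h
  apply hd
  have h1 : gelfandTransform ℂ (Unitization ℂ D) (Unitization.inr d) = 0 := by
    ext ψ
    exact h (restrictCharacter ψ)
  have h2 := (gelfandTransform_isometry (Unitization ℂ D)).injective (h1.trans (map_zero _).symm)
  exact Unitization.inr_injective h2

end PartitionOfUnity

/-! ### Comparison of the distances. -/

section Distance

section General

variable {X : Type*} [SeminormedAddCommGroup X] [Module ℂ X]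

theorem kkDist_comm (S T : Submodule ℂ X) : kkDist S T = kkDist T S :=
  Metric.hausdorffDist_comm

theorem kkDist_le {S T : Submodule ℂ X} {r : ℝ} (hr : 0 ≤ r)
    (hS : ∀ x ∈ S, ‖x‖ ≤ 1 → ∀ ε > 0, ∃ y ∈ T, ‖y‖ ≤ 1 ∧ ‖x - y‖ ≤ r + ε)
    (hT : ∀ y ∈ T, ‖y‖ ≤ 1 → ∀ ε > 0, ∃ x ∈ S, ‖x‖ ≤ 1 ∧ ‖y - x‖ ≤ r + ε) :
    kkDist S T ≤ r := by
  refine le_of_forall_pos_le_add fun ε hε ↦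
    Metric.hausdorffDist_le_of_mem_dist (by positivity) ?_ ?_
  · rintro x ⟨hx, hx1⟩
    obtain ⟨y, hy, hy1, hxy⟩ := hS x hx hx1 ε hε
    exact ⟨y, ⟨hy, hy1⟩, by rwa [dist_eq_norm]⟩
  · rintro y ⟨hy, hy1⟩
    obtain ⟨x, hx, hx1, hxy⟩ := hT y hy hy1 ε hε
    exact ⟨x, ⟨hx, hx1⟩, by rwa [dist_eq_norm]⟩

theorem exists_norm_sub_lt_of_kkDist_lt {S T : Submodule ℂ X} {r : ℝ} (h : kkDist S T < r)
    {x : X} (hx : x ∈ S) (hx1 : ‖x‖ ≤ 1) : ∃ y ∈ T, ‖y‖ ≤ 1 ∧ ‖x - y‖ < r := by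
  have hb (R : Submodule ℂ X) : Bornology.IsBounded {x : X | x ∈ R ∧ ‖x‖ ≤ 1} :=
    (Metric.isBounded_closedBall (x := (0 : X)) (r := 1)).subset
      fun x hx ↦ by simpa using hx.2
  have hn (R : Submodule ℂ X) : {x : X | x ∈ R ∧ ‖x‖ ≤ 1}.Nonempty := ⟨0, R.zero_mem, by simp⟩
  obtain ⟨y, hy, hxy⟩ := Metric.exists_dist_lt_of_hausdorffDist_lt
    (s := {x : X | x ∈ S ∧ ‖x‖ ≤ 1}) ⟨hx, hx1⟩ h
    (Metric.hausdorffEDist_ne_top_of_nonempty_of_bounded (hn S) (hn T) (hb S) (hb T))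
  exact ⟨y, hy.1, hy.2, by rwa [← dist_eq_norm]⟩

/-- The unit ball of a subspace is dense in the unit ball of its closure. -/
theorem exists_mem_norm_le_one_norm_sub_le {X : Type*} [SeminormedAddCommGroup X]
    [NormedSpace ℂ X] {S : Submodule ℂ X} {z : X} (hz : z ∈ S.topologicalClosure) (hz1 : ‖z‖ ≤ 1)
    {ε : ℝ} (hε : 0 < ε) : ∃ y ∈ S, ‖y‖ ≤ 1 ∧ ‖z - y‖ ≤ ε := by
  obtain ⟨y, hy, hzy⟩ := Metric.mem_closure_iff.mp hz (ε / 2) (half_pos hε)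
  rw [dist_eq_norm] at hzy
  have hy1 : ‖y‖ ≤ 1 + ε / 2 := by
    have := norm_sub_norm_le y z
    rw [norm_sub_rev] at this
    linarith
  have hpos : 0 < 1 + ε / 2 := by positivity
  have hn : ‖(((1 + ε / 2)⁻¹ : ℝ) : ℂ)‖ = (1 + ε / 2)⁻¹ := by
    rw [Complex.norm_real, Real.norm_of_nonneg (by positivity)]
  -- A nearby `y` may leave the unit ball by `ε / 2`; rescaling brings it back and moves it by at
  -- most `ε / 2`.
  refine ⟨(((1 + ε / 2)⁻¹ : ℝ) : ℂ) • y, S.smul_mem _ hy, ?_, ?_⟩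
  · rw [norm_smul, hn]
    exact inv_mul_le_one_of_le₀ hy1 hpos.le
  · have h1 : ‖y - (((1 + ε / 2)⁻¹ : ℝ) : ℂ) • y‖ ≤ ε / 2 := by
      have h2 : y - (((1 + ε / 2)⁻¹ : ℝ) : ℂ) • y = ((1 - (1 + ε / 2)⁻¹ : ℝ) : ℂ) • y := by
        push_cast
        module
      have h3 : 1 - (1 + ε / 2)⁻¹ = (1 + ε / 2)⁻¹ * (ε / 2) := by
        field_simp
        ring
      rw [h2, norm_smul, Complex.norm_real, h3, Real.norm_of_nonneg (by positivity)]
      calc _ ≤ (1 + ε / 2)⁻¹ * (ε / 2) * (1 + ε / 2) := by gcongr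
        _ = ε / 2 := by field_simp
    calc _ ≤ ‖z - y‖ + ‖y - (((1 + ε / 2)⁻¹ : ℝ) : ℂ) • y‖ := norm_sub_le_norm_sub_add_norm_sub ..
      _ ≤ ε := by linarith

end General

variable {C : Type u} [NonUnitalCStarAlgebra C]

section Embedding

variable {D : Type v} [NonUnitalCStarAlgebra D]

/-- The canonical map of the algebraic tensor product into the minimal tensor product. -/
noncomputable def algToMin : C ⊗[ℂ] D →ₗ[ℂ] MinTensor C D :=
  (UniformSpace.Completion.toComplₗᵢ (𝕜 := ℂ) (E := AlgTensor C D)).toLinearMap ∘ₗ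
    (show C ⊗[ℂ] D →ₗ[ℂ] AlgTensor C D from LinearMap.id)

theorem algToMin_tmul (c : C) (d : D) : algToMin (c ⊗ₜ[ℂ] d) = elemTensor c d := rfl

theorem norm_algToMin (x : C ⊗[ℂ] D) : ‖algToMin x‖ = minNorm x :=
  UniformSpace.Completion.norm_coe (E := AlgTensor C D) x

theorem algToMin_sum_mem {ι : Type*} (t : Finset ι) {A : NonUnitalStarSubalgebra ℂ C} {a : ι → C}
    (ha : ∀ i, a i ∈ A) (d : ι → D) : algToMin (∑ i ∈ t, a i ⊗ₜ[ℂ] d i) ∈ minTensorSub D A := by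
  rw [map_sum]
  exact Submodule.sum_mem _ fun i _ ↦ Submodule.le_topologicalClosure _
    (Submodule.subset_span ⟨a i, ha i, d i, algToMin_tmul _ _⟩)

/-- Finite sums of elementary tensors in the unit ball are dense in the unit ball. -/
theorem exists_sum_tmul_approx {A : NonUnitalStarSubalgebra ℂ C} {z : MinTensor C D}
    (hz : z ∈ minTensorSub D A) (hz1 : ‖z‖ ≤ 1) {ε : ℝ} (hε : 0 < ε) :
    ∃ (n : ℕ) (a : Fin n → C) (d : Fin n → D), (∀ j, a j ∈ A) ∧
      minNorm (∑ j, a j ⊗ₜ[ℂ] d j) ≤ 1 ∧ ‖z - algToMin (∑ j, a j ⊗ₜ[ℂ] d j)‖ ≤ ε := by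
  obtain ⟨y, hy, hy1, hzy⟩ := exists_mem_norm_le_one_norm_sub_le hz hz1 hε
  obtain ⟨n, f, g, rfl⟩ := Submodule.mem_span_set'.mp hy
  choose a ha d hd using fun j ↦ (g j).2
  have hsum : algToMin (∑ j, a j ⊗ₜ[ℂ] (f j • d j)) = ∑ j, f j • (g j : MinTensor C D) := by
    rw [map_sum]
    refine Finset.sum_congr rfl fun j _ ↦ ?_
    rw [TensorProduct.tmul_smul, map_smul, algToMin_tmul, hd]
  refine ⟨n, a, fun j ↦ f j • d j, ha, ?_, ?_⟩
  · rwa [← norm_algToMin, hsum]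
  · rwa [hsum]

theorem slice_sum_mem {ι : Type*} (t : Finset ι) {A : NonUnitalStarSubalgebra ℂ C} {a : ι → C}
    (ha : ∀ i, a i ∈ A) (d : ι → D) (χ : D →⋆ₙₐ[ℂ] ℂ) :
    slice χ (∑ i ∈ t, a i ⊗ₜ[ℂ] d i) ∈ A := by
  rw [map_sum]
  exact sum_mem fun i _ ↦ by simpa using A.smul_mem (χ (d i)) (ha i)

end Embedding

variable {D : Type v} [NonUnitalCommCStarAlgebra D] {A B : NonUnitalStarSubalgebra ℂ C}

/-- Pass from `z` to a finite sum `x`, then to `∑ (id ⊗ χᵢ)(x) ⊗ sᵢ* sᵢ`, then replace each slice, a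
contraction in `A`, by a nearby contraction in `B`. The errors are `ε / 2`, `ε / 2` and `r`. -/
theorem exists_minTensorSub_approx {r : ℝ} (hr : 0 ≤ r)
    (h : ∀ a ∈ A, ‖a‖ ≤ 1 → ∃ b ∈ B, ‖b‖ ≤ 1 ∧ ‖a - b‖ ≤ r) {z : MinTensor C D}
    (hz : z ∈ minTensorSub D A) (hz1 : ‖z‖ ≤ 1) {ε : ℝ} (hε : 0 < ε) :
    ∃ w ∈ minTensorSub D B, ‖w‖ ≤ 1 ∧ ‖z - w‖ ≤ r + ε := by
  obtain ⟨n, a, d, ha, hx1, hzx⟩ := exists_sum_tmul_approx hz hz1 (half_pos hε)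
  set x := ∑ j, a j ⊗ₜ[ℂ] d j with hx
  have hapos : 0 ≤ ∑ j, ‖a j‖ := Finset.sum_nonneg fun _ _ ↦ norm_nonneg _
  -- The tolerance is divided by the total size of the coefficients `a j`; the `+ 1` avoids division
  -- by zero.
  obtain ⟨ι, _, χ, s, hs1, hs⟩ := exists_character_approx d
    (by positivity : 0 < ε / 2 / (∑ j, ‖a j‖ + 1))
  choose b hb hb1 hab using fun i ↦ h (slice (χ i) x) (slice_sum_mem _ ha d (χ i))
    ((norm_slice_le_minNorm _ _).trans hx1)
  have h1 : minNorm (x - ∑ i, slice (χ i) x ⊗ₜ[ℂ] (star (s i) * s i)) ≤ ε / 2 := by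
    have e : x - ∑ i, slice (χ i) x ⊗ₜ[ℂ] (star (s i) * s i) =
        ∑ j, a j ⊗ₜ[ℂ] (d j - ∑ i, χ i (d j) • (star (s i) * s i)) := by
      simp only [hx, map_sum, slice_tmul, TensorProduct.sum_tmul, TensorProduct.tmul_sub,
        TensorProduct.tmul_sum, Finset.sum_sub_distrib, TensorProduct.smul_tmul]
      rw [Finset.sum_comm]
    rw [e, ← norm_algToMin, map_sum]
    calc _ ≤ ∑ j, ‖a j‖ * (ε / 2 / (∑ j, ‖a j‖ + 1)) := by
          refine norm_sum_le_of_le _ fun j _ ↦ ?_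
          rw [norm_algToMin]
          refine (minNorm_tmul_le _ _).trans ?_
          gcongr
          exact hs j
      _ = (∑ j, ‖a j‖) / (∑ j, ‖a j‖ + 1) * (ε / 2) := by rw [← Finset.sum_mul]; ring
      _ ≤ 1 * (ε / 2) := by
          gcongr
          rw [div_le_one (by positivity)]
          linarith
      _ = ε / 2 := one_mul _
  have h2 : minNorm (∑ i, slice (χ i) x ⊗ₜ[ℂ] (star (s i) * s i) -
      ∑ i, b i ⊗ₜ[ℂ] (star (s i) * s i)) ≤ r := by
    rw [← Finset.sum_sub_distrib]
    simp only [← TensorProduct.sub_tmul]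
    exact minNorm_sum_tmul_star_mul_le _ _ _ hr (fun i _ ↦ hab i) hs1
  refine ⟨algToMin (∑ i, b i ⊗ₜ[ℂ] (star (s i) * s i)), algToMin_sum_mem _ hb _, ?_, ?_⟩
  · rw [norm_algToMin]
    exact minNorm_sum_tmul_star_mul_le _ _ _ zero_le_one (fun i _ ↦ hb1 i) hs1
  · rw [← norm_algToMin, map_sub] at h1 h2
    have h3 := norm_sub_le_norm_sub_add_norm_sub z (algToMin x)
      (algToMin (∑ i, b i ⊗ₜ[ℂ] (star (s i) * s i)))
    have h4 := norm_sub_le_norm_sub_add_norm_sub (algToMin x)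
      (algToMin (∑ i, slice (χ i) x ⊗ₜ[ℂ] (star (s i) * s i)))
      (algToMin (∑ i, b i ⊗ₜ[ℂ] (star (s i) * s i)))
    linarith

theorem kkDist_minTensorSub_le :
    kkDist (minTensorSub D A) (minTensorSub D B) ≤ kkDist (asSubmodule A) (asSubmodule B) := by
  have key (A B : NonUnitalStarSubalgebra ℂ C) (z : MinTensor C D) (hz : z ∈ minTensorSub D A)
      (hz1 : ‖z‖ ≤ 1) (ε : ℝ) (hε : ε > 0) : ∃ w ∈ minTensorSub D B,
      ‖w‖ ≤ 1 ∧ ‖z - w‖ ≤ kkDist (asSubmodule A) (asSubmodule B) + ε := by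
    have hr : 0 ≤ kkDist (asSubmodule A) (asSubmodule B) := Metric.hausdorffDist_nonneg
    obtain ⟨w, hw, hw1, hzw⟩ := exists_minTensorSub_approx (A := A) (B := B)
      -- The infimum defining the distance need not be attained, so half of `ε` is spent on choosing
      -- `b`.
      (r := kkDist (asSubmodule A) (asSubmodule B) + ε / 2) (by positivity)
      (fun a ha ha1 ↦ by
        obtain ⟨b, hb, hb1, hab⟩ := exists_norm_sub_lt_of_kkDist_lt (S := asSubmodule A)
          (lt_add_of_pos_right _ (half_pos hε)) ha ha1
        exact ⟨b, hb, hb1, hab.le⟩) hz hz1 (half_pos hε)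
    exact ⟨w, hw, hw1, by linarith⟩
  refine kkDist_le Metric.hausdorffDist_nonneg (key A B) ?_
  rw [kkDist_comm (asSubmodule A)]
  exact key B A

theorem le_kkDist_minTensorSub {e : D} (he : ‖e‖ ≤ 1) {χ : D →⋆ₙₐ[ℂ] ℂ} (hχ : χ e = 1) :
    kkDist (asSubmodule A) (asSubmodule B) ≤ kkDist (minTensorSub D A) (minTensorSub D B) := by
  have key (A B : NonUnitalStarSubalgebra ℂ C) (a : C) (ha : a ∈ asSubmodule A) (ha1 : ‖a‖ ≤ 1)
      (ε : ℝ) (hε : ε > 0) : ∃ b ∈ asSubmodule B,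
      ‖b‖ ≤ 1 ∧ ‖a - b‖ ≤ kkDist (minTensorSub D A) (minTensorSub D B) + ε := by
    have hmem : algToMin (a ⊗ₜ[ℂ] e) ∈ minTensorSub D A := by
      simpa using algToMin_sum_mem {()} (a := fun _ ↦ a) (fun _ ↦ ha) fun _ ↦ e
    have hnorm : ‖algToMin (a ⊗ₜ[ℂ] e)‖ ≤ 1 := by
      rw [norm_algToMin]
      exact (minNorm_tmul_le a e).trans (mul_le_one₀ ha1 (norm_nonneg _) he)
    obtain ⟨w, hw, hw1, haw⟩ := exists_norm_sub_lt_of_kkDist_lt (T := minTensorSub D B)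
      (lt_add_of_pos_right _ (half_pos hε)) hmem hnorm
    obtain ⟨n, b, d, hb, hx1, hwx⟩ := exists_sum_tmul_approx hw hw1 (half_pos hε)
    refine ⟨slice χ (∑ j, b j ⊗ₜ[ℂ] d j), slice_sum_mem _ hb d χ,
      (norm_slice_le_minNorm _ _).trans hx1, ?_⟩
    have h1 : a - slice χ (∑ j, b j ⊗ₜ[ℂ] d j) = slice χ (a ⊗ₜ[ℂ] e - ∑ j, b j ⊗ₜ[ℂ] d j) := by
      rw [map_sub, slice_tmul, hχ, one_smul]
    rw [h1]
    refine (norm_slice_le_minNorm _ _).trans ?_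
    rw [← norm_algToMin, map_sub]
    have h2 := norm_sub_le_norm_sub_add_norm_sub (algToMin (a ⊗ₜ[ℂ] e)) w
      (algToMin (∑ j, b j ⊗ₜ[ℂ] d j))
    linarith
  refine kkDist_le Metric.hausdorffDist_nonneg (key A B) ?_
  rw [kkDist_comm (minTensorSub D A)]
  exact key B A

end Distance
end KadisonKastler

theorem theorem4p5 {C : Type u} [NonUnitalCStarAlgebra C]
    {D : Type v} [NonUnitalCommCStarAlgebra D]
    (A B : NonUnitalStarSubalgebra ℂ C)
    (hA : IsClosed (A : Set C)) (hB : IsClosed (B : Set C)) :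
    KadisonKastler.kkDist (KadisonKastler.minTensorSub D A) (KadisonKastler.minTensorSub D B)
        ≤ KadisonKastler.kkDist (KadisonKastler.asSubmodule A) (KadisonKastler.asSubmodule B) ∧
      (Nontrivial D → (∃ e : D, ∀ d : D, e * d = d ∧ d * e = d) →
        KadisonKastler.kkDist (KadisonKastler.minTensorSub D A) (KadisonKastler.minTensorSub D B)
          = KadisonKastler.kkDist (KadisonKastler.asSubmodule A)
              (KadisonKastler.asSubmodule B)) := by
  refine ⟨KadisonKastler.kkDist_minTensorSub_le, fun _ ⟨e, he⟩ ↦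
    le_antisymm KadisonKastler.kkDist_minTensorSub_le ?_⟩
  have he1 : ‖e‖ ≤ 1 := by
    -- Since `e* e = e*`, the C*-identity reads `‖e‖ = ‖e‖²`.
    have h1 := CStarRing.norm_star_mul_self (x := e)
    rw [(he (star e)).2, norm_star] at h1
    nlinarith
  obtain ⟨d, hd⟩ := exists_ne (0 : D)
  obtain ⟨χ, hχ⟩ := KadisonKastler.exists_character_apply_ne_zero hd
  have hχe : χ e = 1 := by
    have h1 : χ e * χ d = χ d := by rw [← map_mul, (he d).1]
    exact (mul_eq_right₀ hχ).mp h1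
  exact KadisonKastler.le_kkDist_minTensorSub he1 hχe
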